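/- Let $V$ be a finite set and let $E$ be a set of undirected edges on $V$, self-loops $(i,i)$ being allowed. Let $G=(V,E,c_V^G,c_E^G)$ and $H=(V,E,c_V^H,c_E^H)$ be two capacitated graphs with this vertex set and edge set, with vertex capacities $c_V^G,c_V^H:V\to\mathbb{R}_{\ge 0}$ and edge capacities $c_E^G,c_E^H:E\to\mathbb{R}_{\ge 0}$. A function $\mu:E\to\mathbb{R}_{\ge0}$, extended by $\mu(i,j)=0$ to pairs $(i,j)\notin E$, is a feasible fractional matching of $(V,E,c_V,c_E)$ if $\mu(i,j)\le c_E(i,j)$ for every edge $(i,j)$ and $\sum_{j}\mu(i,j)\le c_V(i)$ for every vertex $i$ (a self-loop $(i,i)$ counts once in this sum). A vertex $i$ is saturated by $\mu$ if $\sum_j\mu(i,j)=c_V(i)$, and an edge $(i,j)$ is saturated if $\mu(i,j)=c_E(i,j)$. The algorithm $\mathsf{Rising\text{-}Tide}(V,E,c_V,c_E)$ is the following. Start with $E'=\{(i,j)\in E: c_E(i,j)>0\}$ and $\mu=0$. While $E'\ne\emptyset$: let $\epsilon\ge 0$ be maximum such that $\mu+\epsilon\mathbf{1}_{E'}$ is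 a feasible fractional matching, replace $\mu$ by $\mu+\epsilon\mathbf 1_{E'}$, and then remove from $E'$ every edge $(i,j)$ for which $i$ or $j$ or $(i,j)$ is saturated. When $E'=\emptyset$, return $\mu$. Let $\mu_G$ and $\mu_H$ be the fractional matchings computed by $\mathsf{Rising\text{-}Tide}$ on $G$ and $H$ respectively, and let $$\eta_V=\sum_{i\in V}|c_V^G(i)-c_V^H(i)|,\qquad \eta_E=\sum_{(i,j)\in E}|c_E^G(i,j)-c_E^H(i,j)|,$$ where in $\eta_E$ each undirected edge is counted once. Then $$\sum_{i\in V}\left|\Big(c_V^G(i)-\sum_j\mu_G(i,j)\Big)-\Big(c_V^H(i)-\sum_j\mu_H(i,j)\Big)\right|\le \eta_V+2\eta_E .$$ -/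

import Mathlib

/-- A finite undirected graph `(V, E, c_V, c_E)`, self-loops allowed, with nonnegative capacities on
its vertices and edges.  An undirected edge `(i, j) = (j, i)` is the unordered pair `s(i, j)`.  Only
the values of `edgeCap` on `edges` play a role. -/
structure CapacitatedGraph (V : Type*) where
  edges : Finset (Sym2 V)
  vertexCap : V → ℝ
  edgeCap : Sym2 V → ℝ
  vertexCap_nonneg : ∀ i, 0 ≤ vertexCap i
  edgeCap_nonneg : ∀ e ∈ edges, 0 ≤ edgeCap e

namespace CapacitatedGraph

variable {V : Type*} [Fintype V]

/-- The saturation level `∑ j, μ(i, j)` of the vertex `i`; a self-loop `(i, i)` counts once. -/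
def level (μ : Sym2 V → ℝ) (i : V) : ℝ := ∑ j, μ s(i, j)

/-- Feasible fractional matchings; a function on the edges is extended by `0` to all pairs. -/
structure IsFeasible (G : CapacitatedGraph V) (μ : Sym2 V → ℝ) : Prop where
  eq_zero : ∀ e, e ∉ G.edges → μ e = 0
  nonneg : ∀ e ∈ G.edges, 0 ≤ μ e
  le_edgeCap : ∀ e ∈ G.edges, μ e ≤ G.edgeCap e
  level_le : ∀ i, level μ i ≤ G.vertexCap i

/-- The vertex `i` is saturated. -/
def VertexSaturated (G : CapacitatedGraph V) (μ : Sym2 V → ℝ) (i : V) : Prop :=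
  level μ i = G.vertexCap i

/-- The edge `e` is saturated. -/
def EdgeSaturated (G : CapacitatedGraph V) (μ : Sym2 V → ℝ) (e : Sym2 V) : Prop :=
  μ e = G.edgeCap e

open scoped Classical in
/-- The matching `μ + ε μ_{E'}`, where `μ_{E'}` is the indicator function of the set `W = E'`. -/
noncomputable def raise (W : Finset (Sym2 V)) (μ : Sym2 V → ℝ) (ε : ℝ) : Sym2 V → ℝ :=
  fun e => μ e + ε * (if e ∈ W then 1 else 0)

/-- The maximum `ε ≥ 0` such that `μ + ε μ_{E'}` is a feasible fractional matching; that it is a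
maximum is `isGreatest_increment` below. -/
noncomputable def increment (G : CapacitatedGraph V) (W : Finset (Sym2 V)) (μ : Sym2 V → ℝ) : ℝ :=
  sSup {ε : ℝ | 0 ≤ ε ∧ G.IsFeasible (raise W μ ε)}

open scoped Classical in
/-- One pass through the body of the while loop, on the state `(E', μ)`: raise `μ` on `E'` as far as
possible, then remove from `E'` the edges `(i, j)` for which `i` or `j` or `(i, j)` is saturated. -/
noncomputable def body (G : CapacitatedGraph V) (s : Finset (Sym2 V) × (Sym2 V → ℝ)) :
    Finset (Sym2 V) × (Sym2 V → ℝ) :=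
  let μ' := raise s.1 s.2 (G.increment s.1 s.2)
  (s.1.filter fun e => ¬ ((∃ i ∈ e, G.VertexSaturated μ' i) ∨ G.EdgeSaturated μ' e), μ')

open scoped Classical in
/-- The loop body, guarded by the loop condition `E' ≠ ∅`. -/
noncomputable def guardedBody (G : CapacitatedGraph V) (s : Finset (Sym2 V) × (Sym2 V → ℝ)) :
    Finset (Sym2 V) × (Sym2 V → ℝ) :=
  if s.1 = ∅ then s else G.body s

open scoped Classical in
/-- The initial state: `E'` consists of the edges of positive capacity, and `μ = 0`. -/
noncomputable def initState (G : CapacitatedGraph V) : Finset (Sym2 V) × (Sym2 V → ℝ) :=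
  (G.edges.filter fun e => 0 < G.edgeCap e, 0)

/-- The state after `k` passes through the loop (or after the loop has ended, if that is earlier). -/
noncomputable def stateAfter (G : CapacitatedGraph V) (k : ℕ) : Finset (Sym2 V) × (Sym2 V → ℝ) :=
  G.guardedBody^[k] G.initState

/-- The output of the Rising-Tide algorithm.  The loop ends after at most `|E|` passes, which is
`stateAfter_card_edges` below. -/
noncomputable def risingTide (G : CapacitatedGraph V) : Sym2 V → ℝ :=
  (G.stateAfter G.edges.card).2

theorem level_raise_continuous (W : Finset (Sym2 V)) (μ : Sym2 V → ℝ) (i : V) :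
    Continuous fun ε => level (raise W μ ε) i := by
  unfold level raise
  fun_prop

theorem isGreatest_increment (G : CapacitatedGraph V) {W : Finset (Sym2 V)} {μ : Sym2 V → ℝ}
    (hW : W ⊆ G.edges) (hne : W ≠ ∅) (hμ : G.IsFeasible μ) :
    IsGreatest {ε : ℝ | 0 ≤ ε ∧ G.IsFeasible (raise W μ ε)} (G.increment W μ) := by
  obtain ⟨e₀, he₀⟩ := Finset.nonempty_iff_ne_empty.2 hne
  have h0 : (0 : ℝ) ∈ {ε : ℝ | 0 ≤ ε ∧ G.IsFeasible (raise W μ ε)} := by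
    have : raise W μ 0 = μ := by funext e; simp [raise]
    exact ⟨le_rfl, by rw [this]; exact hμ⟩
  have hb : BddAbove {ε : ℝ | 0 ≤ ε ∧ G.IsFeasible (raise W μ ε)} := by
    refine ⟨G.edgeCap e₀, fun ε hε => ?_⟩
    have h1 := hε.2.le_edgeCap e₀ (hW he₀)
    have h2 := hμ.nonneg e₀ (hW he₀)
    simp only [raise, he₀, if_true, mul_one] at h1
    linarith
  have hc : IsClosed {ε : ℝ | 0 ≤ ε ∧ G.IsFeasible (raise W μ ε)} := by
    have : {ε : ℝ | 0 ≤ ε ∧ G.IsFeasible (raise W μ ε)} =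
        {ε : ℝ | 0 ≤ ε} ∩ ((⋂ e ∈ G.edges, {ε : ℝ | raise W μ ε e ≤ G.edgeCap e}) ∩
          ⋂ i, {ε : ℝ | level (raise W μ ε) i ≤ G.vertexCap i}) := by
      ext ε
      simp only [Set.mem_ofPred_eq, Set.mem_inter_iff, Set.mem_iInter]
      constructor
      · rintro ⟨h, hf⟩
        exact ⟨h, hf.le_edgeCap, hf.level_le⟩
      · rintro ⟨h, h1, h2⟩
        refine ⟨h, fun e he => ?_, fun e he => ?_, h1, h2⟩
        · have : e ∉ W := fun h' => he (hW h')
          simp [raise, this, hμ.eq_zero e he]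
        · have := hμ.nonneg e he
          unfold raise
          split_ifs <;> nlinarith
    rw [this]
    refine isClosed_Ici.inter (IsClosed.inter ?_ ?_)
    · refine isClosed_biInter fun e _ => isClosed_le ?_ continuous_const
      unfold raise
      fun_prop
    · exact isClosed_iInter fun i => isClosed_le (level_raise_continuous W μ i) continuous_const
  exact ⟨hc.csSup_mem ⟨0, h0⟩ hb, fun ε hε => le_csSup hb hε⟩

theorem body_feasible (G : CapacitatedGraph V) {s : Finset (Sym2 V) × (Sym2 V → ℝ)}
    (hW : s.1 ⊆ G.edges) (hne : s.1 ≠ ∅) (hμ : G.IsFeasible s.2) : G.IsFeasible (G.body s).2 :=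
  (G.isGreatest_increment hW hne hμ).1.2

open scoped Classical in
theorem body_card_lt (G : CapacitatedGraph V) {s : Finset (Sym2 V) × (Sym2 V → ℝ)}
    (hW : s.1 ⊆ G.edges) (hne : s.1 ≠ ∅) (hμ : G.IsFeasible s.2) :
    (G.body s).1.card < s.1.card := by
  obtain ⟨W, μ⟩ := s
  obtain ⟨⟨hpos, hf⟩, hmax⟩ := G.isGreatest_increment hW hne hμ
  dsimp only at *
  refine Finset.card_lt_card ((Finset.filter_ssubset).2 ?_)
  by_contra! hcon
  set ε := G.increment W μ with hε
  have hedge : ∀ᶠ t in nhds ε, ∀ e ∈ G.edges, raise W μ t e ≤ G.edgeCap e := by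
    rw [Filter.eventually_all_finset]
    intro e he
    by_cases heW : e ∈ W
    · have hlt : raise W μ ε e < G.edgeCap e :=
        lt_of_le_of_ne (hf.le_edgeCap e he) fun h => (hcon e heW).2 h
      have hcont : Continuous fun t => raise W μ t e := by unfold raise; fun_prop
      exact (hcont.continuousAt.eventually_lt continuousAt_const hlt).mono fun t ht => ht.le
    · refine Filter.Eventually.of_forall fun t => ?_
      simpa [raise, heW] using hμ.le_edgeCap e he
  have hvert : ∀ᶠ t in nhds ε, ∀ i, level (raise W μ t) i ≤ G.vertexCap i := by
    rw [Filter.eventually_all]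
    intro i
    by_cases hi : ∃ e ∈ W, i ∈ e
    · obtain ⟨e, heW, hie⟩ := hi
      have hlt : level (raise W μ ε) i < G.vertexCap i :=
        lt_of_le_of_ne (hf.level_le i) fun h => (hcon e heW).1 i hie h
      exact ((level_raise_continuous W μ i).continuousAt.eventually_lt
        continuousAt_const hlt).mono fun t ht => ht.le
    · refine Filter.Eventually.of_forall fun t => ?_
      have : level (raise W μ t) i = level μ i := by
        refine Finset.sum_congr rfl fun j _ => ?_
        have : s(i, j) ∉ W := fun h => hi ⟨_, h, Sym2.mem_mk_left i j⟩
        simp [raise, this]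
      rw [this]
      exact hμ.level_le i
  have hev : ∀ᶠ t in nhdsWithin ε (Set.Ioi ε), (∀ e ∈ G.edges, raise W μ t e ≤ G.edgeCap e) ∧
      (∀ i, level (raise W μ t) i ≤ G.vertexCap i) ∧ ε < t := by
    filter_upwards [nhdsWithin_le_nhds hedge, nhdsWithin_le_nhds hvert, self_mem_nhdsWithin]
      with t h1 h2 h3 using ⟨h1, h2, h3⟩
  obtain ⟨t, h1, h2, h3⟩ := hev.exists
  refine absurd (hmax ⟨by linarith, fun e he => ?_, fun e he => ?_, h1, h2⟩) (not_le.2 h3)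
  · have : e ∉ W := fun h' => he (hW h')
    simp [raise, this, hμ.eq_zero e he]
  · have := hμ.nonneg e he
    unfold raise
    split_ifs <;> nlinarith

open scoped Classical in
theorem stateAfter_invariant (G : CapacitatedGraph V) (k : ℕ) :
    (G.stateAfter k).1 ⊆ G.edges ∧ G.IsFeasible (G.stateAfter k).2 ∧
      (G.stateAfter k).1.card ≤ G.edges.card - k := by
  induction k with
  | zero =>
    refine ⟨Finset.filter_subset _ _, ⟨?_, ?_, ?_, ?_⟩, Finset.card_le_card (Finset.filter_subset _ _)⟩
    · intro e _; rfl
    · intro e _; exact le_rfl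
    · exact G.edgeCap_nonneg
    · intro i
      simpa [stateAfter, initState, level] using G.vertexCap_nonneg i
  | succ k ih =>
    obtain ⟨h1, h2, h3⟩ := ih
    have hs : G.stateAfter (k + 1) = G.guardedBody (G.stateAfter k) :=
      Function.iterate_succ_apply' _ _ _
    rw [hs]
    unfold guardedBody
    split_ifs with h
    · exact ⟨h1, h2, by simp [h]⟩
    · refine ⟨(Finset.filter_subset _ _).trans h1, G.body_feasible h1 h h2, ?_⟩
      have := G.body_card_lt h1 h h2
      omega

/-- After `|E|` passes the working set is empty, so the while loop has ended. -/
theorem stateAfter_card_edges (G : CapacitatedGraph V) : (G.stateAfter G.edges.card).1 = ∅ := by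
  have := (G.stateAfter_invariant G.edges.card).2.2
  rw [Nat.sub_self] at this
  exact Finset.card_eq_zero.1 (Nat.le_zero.1 this)

/-- The residual capacity `c_V(i) - ∑ j, μ(i, j)` of the vertex `i` when `μ` is the output of the
Rising-Tide algorithm. -/
noncomputable def residual (G : CapacitatedGraph V) (i : V) : ℝ :=
  G.vertexCap i - ∑ j, G.risingTide s(i, j)

end CapacitatedGraph

/-! The output of Rising-Tide is a pointwise minimum: `μ(i, j) = min (c_E(i, j)) (min (t i) (t j))`,
where `t i` equals a trivial bound `T` unless `i` is saturated (`exists_threshold`). Take the same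
`T` for `G` and `H`, with thresholds `t` and `u`. If `i` has more residual capacity in `G`, it is
unsaturated there, so `t i = T ≥ u i`. Hence a sign `σ i` of the residual difference also orders the
thresholds.

With `d = μ_H - μ_G`, the total residual change is at most `η_V + ∑ i, σ i * level d i`.
Symmetrizing gives each ordered pair the weight `(σ i + σ j) / 2`: opposite signs cancel, and
otherwise both thresholds move the same way, so that only the change of edge capacity can push `d`
in the direction of the sign. Each edge occurs in at most two ordered pairs, whence `2 η_E`. -/

namespace CapacitatedGraph

variable {V : Type*} [Fintype V]

/-! ### Bottleneck structure of the output -/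

/-- Every edge outside `W` is saturated, or has a saturated endpoint none of whose edges is in `W`
or carries more than the edge itself; the edges of `W` all carry the largest value of `μ`. -/
def IsTideState (G : CapacitatedGraph V) (W : Finset (Sym2 V)) (μ : Sym2 V → ℝ) : Prop :=
  (∃ τ : ℝ, (∀ e, μ e ≤ τ) ∧ ∀ e ∈ W, μ e = τ) ∧
    ∀ e ∈ G.edges, e ∉ W → G.EdgeSaturated μ e ∨
      ∃ i ∈ e, G.VertexSaturated μ i ∧ ∀ j, μ s(i, j) ≤ μ e ∧ s(i, j) ∉ W

theorem isTideState_initState (G : CapacitatedGraph V) :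
    G.IsTideState G.initState.1 G.initState.2 := by
  refine ⟨⟨0, fun _ => le_rfl, fun _ _ => rfl⟩, fun e he hW => Or.inl ?_⟩
  have h : ¬ 0 < G.edgeCap e := fun h => hW (Finset.mem_filter.2 ⟨he, h⟩)
  exact le_antisymm (G.edgeCap_nonneg e he) (not_lt.1 h)

/-- Edges in the working set rise together, so they keep the largest value. An edge removed now
carries that value, and a saturated endpoint loses all its working edges at once. An older witness
vertex has no working edge, so nothing at it moves any more. -/
theorem IsTideState.body {G : CapacitatedGraph V} {s : Finset (Sym2 V) × (Sym2 V → ℝ)}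
    (hs : G.IsTideState s.1 s.2) (hW : s.1 ⊆ G.edges) (hne : s.1 ≠ ∅) (hμ : G.IsFeasible s.2) :
    G.IsTideState (G.body s).1 (G.body s).2 := by
  classical
  obtain ⟨W, μ⟩ := s
  obtain ⟨⟨τ, hle, heq⟩, hout⟩ := hs
  have hε : 0 ≤ G.increment W μ := (G.isGreatest_increment hW hne hμ).1.1
  have hmem : ∀ e, e ∈ (G.body (W, μ)).1 ↔ e ∈ W ∧
      ¬ ((∃ i ∈ e, G.VertexSaturated (G.body (W, μ)).2 i) ∨
        G.EdgeSaturated (G.body (W, μ)).2 e) := fun e => Finset.mem_filter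
  have hin : ∀ e ∈ W, (G.body (W, μ)).2 e = τ + G.increment W μ := fun e he => by
    have := heq e he
    simp_all [CapacitatedGraph.body, raise]
  have hnot : ∀ e, e ∉ W → (G.body (W, μ)).2 e = μ e := fun e he => by
    simp [CapacitatedGraph.body, raise, he]
  have hle' : ∀ e, (G.body (W, μ)).2 e ≤ τ + G.increment W μ := fun e => by
    by_cases he : e ∈ W
    · exact (hin e he).le
    · rw [hnot e he]
      linarith [hle e]
  refine ⟨⟨_, hle', fun e he => hin e ((hmem e).1 he).1⟩, fun e he heW => ?_⟩
  by_cases h : e ∈ W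
  · have h1 : (∃ i ∈ e, G.VertexSaturated (G.body (W, μ)).2 i) ∨
        G.EdgeSaturated (G.body (W, μ)).2 e := by
      by_contra hcon
      exact heW ((hmem e).2 ⟨h, hcon⟩)
    refine h1.symm.imp_right ?_
    rintro ⟨i, hie, hi⟩
    refine ⟨i, hie, hi, fun j => ⟨(hle' _).trans (hin e h).ge, fun hj => ?_⟩⟩
    exact ((hmem _).1 hj).2 (Or.inl ⟨i, Sym2.mem_mk_left i j, hi⟩)
  · refine (hout e he h).imp (fun h1 => (hnot e h).trans h1) ?_
    rintro ⟨i, hie, hi, hmax⟩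
    refine ⟨i, hie, ?_, fun j => ⟨?_, fun hj => (hmax j).2 ((hmem _).1 hj).1⟩⟩
    · exact (Finset.sum_congr rfl fun j _ => hnot _ (hmax j).2).trans hi
    · rw [hnot _ (hmax j).2, hnot e h]
      exact (hmax j).1

theorem isTideState_stateAfter (G : CapacitatedGraph V) (k : ℕ) :
    G.IsTideState (G.stateAfter k).1 (G.stateAfter k).2 := by
  induction k with
  | zero => exact G.isTideState_initState
  | succ k ih =>
    obtain ⟨h1, h2, -⟩ := G.stateAfter_invariant k
    have hs : G.stateAfter (k + 1) = G.guardedBody (G.stateAfter k) :=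
      Function.iterate_succ_apply' _ _ _
    rw [hs]
    unfold guardedBody
    split_ifs with h
    · exact ih
    · exact ih.body h1 h h2

theorem isFeasible_risingTide (G : CapacitatedGraph V) : G.IsFeasible G.risingTide :=
  (G.stateAfter_invariant _).2.1

/-- In the output of Rising-Tide, every edge is saturated or has a saturated endpoint at which no
edge carries more. -/
theorem risingTide_bottleneck (G : CapacitatedGraph V) {e : Sym2 V} (he : e ∈ G.edges) :
    G.EdgeSaturated G.risingTide e ∨ ∃ i ∈ e, G.VertexSaturated G.risingTide i ∧
      ∀ j, G.risingTide s(i, j) ≤ G.risingTide e := by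
  have h := (G.isTideState_stateAfter G.edges.card).2 e he
    (by rw [G.stateAfter_card_edges]; exact Finset.notMem_empty e)
  exact h.imp_right fun ⟨i, hie, hi, hmax⟩ => ⟨i, hie, hi, fun j => (hmax j).1⟩

theorem residual_nonneg (G : CapacitatedGraph V) (i : V) : 0 ≤ G.residual i :=
  sub_nonneg.2 (G.isFeasible_risingTide.level_le i)

/-! ### Thresholds at the vertices -/

/-- The output of Rising-Tide is the minimum of the edge capacity and of a threshold at each
endpoint; the threshold is the trivial bound `T` at the vertices with residual capacity. -/
theorem exists_threshold (G : CapacitatedGraph V) {T : ℝ} (hT : ∀ e ∈ G.edges, G.edgeCap e ≤ T)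
    (hT0 : 0 ≤ T) :
    ∃ t : V → ℝ, (∀ i, t i ≤ T) ∧ (∀ i, 0 < G.residual i → t i = T) ∧
      ∀ i j, s(i, j) ∈ G.edges →
        G.risingTide s(i, j) = min (G.edgeCap s(i, j)) (min (t i) (t j)) := by
  classical
  have hf := G.isFeasible_risingTide
  have hle : ∀ e, G.risingTide e ≤ T := fun e => by
    by_cases he : e ∈ G.edges
    · exact (hf.le_edgeCap e he).trans (hT e he)
    · exact (hf.eq_zero e he).trans_le hT0
  -- The largest value carried at `i` serves as threshold when `i` is saturated: a bottleneck
  -- endpoint of an edge then has exactly the value of that edge as threshold.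
  let m : V → ℝ := fun i => Finset.univ.sup' ⟨i, Finset.mem_univ i⟩ fun j => G.risingTide s(i, j)
  let t : V → ℝ := fun i => if G.VertexSaturated G.risingTide i then m i else T
  have hlt : ∀ i j, G.risingTide s(i, j) ≤ t i := fun i j => by
    dsimp only [t]
    split_ifs
    · exact Finset.le_sup' (fun j => G.risingTide s(i, j)) (Finset.mem_univ j)
    · exact hle _
  refine ⟨t, fun i => ?_, fun i hi => if_neg fun h => ?_, fun i j he => ?_⟩
  · dsimp only [t]
    split_ifs
    · exact Finset.sup'_le _ _ fun j _ => hle _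
    · exact le_rfl
  · exact hi.ne' (sub_eq_zero.2 h.symm)
  · refine le_antisymm (le_min (hf.le_edgeCap _ he) (le_min (hlt i j) ?_)) ?_
    · rw [Sym2.eq_swap]
      exact hlt j i
    · obtain h | ⟨k, hk, hsat, hmax⟩ := G.risingTide_bottleneck he
      · exact (min_le_left _ _).trans h.ge
      · have htk : t k ≤ G.risingTide s(i, j) := by
          dsimp only [t]
          rw [if_pos hsat]
          exact Finset.sup'_le _ _ fun j _ => hmax j
        refine (min_le_right _ _).trans (le_trans ?_ htk)
        obtain rfl | rfl := Sym2.mem_iff.1 hk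
        · exact min_le_left _ _
        · exact min_le_right _ _

/-! ### Summation and sign lemmas -/

/-- Summing over ordered pairs counts every unordered pair at most twice. -/
theorem sum_sum_mk_le_two_mul_sum (E : Finset (Sym2 V)) (g : Sym2 V → ℝ)
    (hE : ∀ e ∈ E, 0 ≤ g e) (hE' : ∀ e, e ∉ E → g e = 0) :
    ∑ i, ∑ j, g s(i, j) ≤ 2 * ∑ e ∈ E, g e := by
  classical
  have h1 : ∑ i, ∑ j, g s(i, j) = ∑ p : V × V with s(p.1, p.2) ∈ E, g s(p.1, p.2) := by
    rw [← Finset.univ_product_univ, Finset.sum_filter_of_ne, Finset.sum_product]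
    intro p _ hp
    by_contra h
    exact hp (hE' _ h)
  rw [h1, ← Finset.sum_fiberwise_of_maps_to (g := fun p : V × V => s(p.1, p.2)) (t := E)
    (fun p hp => (Finset.mem_filter.1 hp).2), Finset.mul_sum]
  refine Finset.sum_le_sum fun e he => ?_
  rw [Finset.sum_congr rfl (g := fun _ => g e)
    (fun p hp => by rw [(Finset.mem_filter.1 hp).2]), Finset.sum_const, nsmul_eq_mul]
  refine mul_le_mul_of_nonneg_right ?_ (hE e he)
  induction e with
  | h a b =>
    refine (Nat.cast_le.2 ((Finset.card_le_card (t := {(a, b), (b, a)}) fun p hp => ?_).trans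
      Finset.card_le_two)).trans_eq Nat.cast_ofNat
    have := (Finset.mem_filter.1 hp).2
    rw [Sym2.eq_iff] at this
    simpa [Prod.ext_iff] using this

/-- Averaging a sum over ordered pairs with its transpose. -/
theorem sum_mul_level_le (σ : V → ℝ) (d g : Sym2 V → ℝ)
    (h : ∀ i j, (σ i + σ j) * d s(i, j) ≤ 2 * g s(i, j)) :
    ∑ i, σ i * level d i ≤ ∑ i, ∑ j, g s(i, j) := by
  have h1 : ∑ i, σ i * level d i = ∑ i, ∑ j, σ i * d s(i, j) := by
    simp only [level, Finset.mul_sum]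
  have h2 : ∑ i, ∑ j, σ i * d s(i, j) = ∑ i, ∑ j, σ j * d s(i, j) := by
    rw [Finset.sum_comm]
    simp only [Sym2.eq_swap]
  have h3 : ∑ i, ∑ j, (σ i + σ j) * d s(i, j) ≤ ∑ i, ∑ j, 2 * g s(i, j) :=
    Finset.sum_le_sum fun i _ => Finset.sum_le_sum fun j _ => h i j
  simp only [add_mul, Finset.sum_add_distrib, ← Finset.mul_sum] at h3
  simp only [← Finset.mul_sum] at h1 h2
  linarith

/-- The minimum is monotone in the thresholds and 1-Lipschitz in the capacity. -/
theorem min_min_sub_min_min_le {a b c a' b' c' : ℝ} (hb : b ≤ b') (hc : c ≤ c') :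
    min a (min b c) - min a' (min b' c') ≤ |a - a'| := by
  have h := le_abs_self (a - a')
  have h0 := abs_nonneg (a - a')
  rw [sub_le_iff_le_add', ← sub_le_iff_le_add]
  refine le_min ?_ ((sub_le_self _ h0).trans ((min_le_right _ _).trans (min_le_min hb hc)))
  linarith [min_le_left a (min b c)]

/-- A sign for the difference of the residuals `r, r'` that also records which of the thresholds
`t, u` is larger. -/
theorem exists_compatible_sign {t u r r' : ℝ} (h1 : r' < r → u ≤ t) (h2 : r < r' → t ≤ u) :
    ∃ σ : ℝ, (σ = 1 ∧ u ≤ t ∨ σ = -1 ∧ t ≤ u ∨ σ = 0 ∧ t = u) ∧ |r - r'| = σ * (r - r') := by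
  rcases lt_trichotomy r r' with h | h | h
  · exact ⟨-1, Or.inr (Or.inl ⟨rfl, h2 h⟩), by rw [abs_of_neg (sub_neg.2 h)]; ring⟩
  · subst h
    rcases lt_trichotomy t u with h | h | h
    · exact ⟨-1, Or.inr (Or.inl ⟨rfl, h.le⟩), by simp⟩
    · exact ⟨0, Or.inr (Or.inr ⟨rfl, h⟩), by simp⟩
    · exact ⟨1, Or.inl ⟨rfl, h.le⟩, by simp⟩
  · exact ⟨1, Or.inl ⟨rfl, h1 h⟩, by rw [abs_of_pos (sub_pos.2 h)]; ring⟩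

end CapacitatedGraph

theorem mainTheorem4 {V : Type*} [Fintype V] (G H : CapacitatedGraph V)
    (hE : G.edges = H.edges) :
    ∑ i : V, |G.residual i - H.residual i| ≤
      ∑ i : V, |G.vertexCap i - H.vertexCap i| +
        2 * ∑ e ∈ G.edges, |G.edgeCap e - H.edgeCap e| := by
  classical
  -- Cut off to `0` outside the edges, where `edgeCap` is arbitrary.
  let g : Sym2 V → ℝ := fun e => if e ∈ G.edges then |G.edgeCap e - H.edgeCap e| else 0
  obtain ⟨T, hT0, hTG, hTH⟩ : ∃ T : ℝ, 0 ≤ T ∧ (∀ e ∈ G.edges, G.edgeCap e ≤ T) ∧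
      ∀ e ∈ H.edges, H.edgeCap e ≤ T := by
    have hG := Finset.sum_nonneg G.edgeCap_nonneg
    have hH := Finset.sum_nonneg H.edgeCap_nonneg
    -- Any bound common to both graphs would do; the sum of all capacities is one.
    refine ⟨∑ e ∈ G.edges, G.edgeCap e + ∑ e ∈ H.edges, H.edgeCap e, add_nonneg hG hH,
      fun e he => ?_, fun e he => ?_⟩
    · linarith [Finset.single_le_sum G.edgeCap_nonneg he]
    · linarith [Finset.single_le_sum H.edgeCap_nonneg he]
  obtain ⟨t, htT, htr, ht⟩ := G.exists_threshold hTG hT0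
  obtain ⟨u, huT, hur, hu⟩ := H.exists_threshold hTH hT0
  -- The strictly larger residual is positive because the other is nonnegative, so its threshold is
  -- the common maximum `T`.
  choose σ hσ hσr using fun i => CapacitatedGraph.exists_compatible_sign (t := t i) (u := u i)
    (r := G.residual i) (r' := H.residual i)
    (fun h => (huT i).trans (htr i ((H.residual_nonneg i).trans_lt h)).ge)
    (fun h => (htT i).trans (hur i ((G.residual_nonneg i).trans_lt h)).ge)
  let d : Sym2 V → ℝ := fun e => H.risingTide e - G.risingTide e
  have hd : ∀ i j, (σ i + σ j) * d s(i, j) ≤ 2 * g s(i, j) := fun i j => by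
    by_cases he : s(i, j) ∈ G.edges
    · have hg : g s(i, j) = |G.edgeCap s(i, j) - H.edgeCap s(i, j)| := if_pos he
      have h0 : 0 ≤ g s(i, j) := hg ▸ abs_nonneg _
      have hup : u i ≤ t i → u j ≤ t j → d s(i, j) ≤ g s(i, j) := fun hi hj => by
        simp only [d]
        rw [hg, abs_sub_comm, ht i j he, hu i j (hE ▸ he)]
        exact CapacitatedGraph.min_min_sub_min_min_le hi hj
      have hdown : t i ≤ u i → t j ≤ u j → -d s(i, j) ≤ g s(i, j) := fun hi hj => by
        simp only [d]
        rw [hg, neg_sub, ht i j he, hu i j (hE ▸ he)]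
        exact CapacitatedGraph.min_min_sub_min_min_le hi hj
      -- Signs `1` and `-1` cancel; a sign `0` means equal thresholds, which fit either direction.
      rcases hσ i with ⟨hi, hi'⟩ | ⟨hi, hi'⟩ | ⟨hi, hi'⟩ <;>
        rcases hσ j with ⟨hj, hj'⟩ | ⟨hj, hj'⟩ | ⟨hj, hj'⟩ <;> rw [hi, hj]
      · linarith [hup hi' hj']
      · linarith
      · linarith [hup hi' hj'.ge]
      · linarith
      · linarith [hdown hi' hj']
      · linarith [hdown hi' hj'.le]
      · linarith [hup hi'.ge hj']
      · linarith [hdown hi'.le hj']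
      · linarith
    · have h1 : d s(i, j) = 0 := by
        simp only [d]
        rw [G.isFeasible_risingTide.eq_zero _ he, H.isFeasible_risingTide.eq_zero _ (hE ▸ he),
          sub_zero]
      have h2 : g s(i, j) = 0 := if_neg he
      rw [h1, h2, mul_zero, mul_zero]
  have hlevel : ∀ i, G.residual i - H.residual i =
      (G.vertexCap i - H.vertexCap i) + CapacitatedGraph.level d i := fun i => by
    simp only [CapacitatedGraph.residual, CapacitatedGraph.level, d, Finset.sum_sub_distrib]
    ring
  have hvert : ∀ i, |G.residual i - H.residual i| ≤
      |G.vertexCap i - H.vertexCap i| + σ i * CapacitatedGraph.level d i := fun i => by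
    rw [hσr i, hlevel i, mul_add]
    refine add_le_add_left ?_ _
    -- Only `|σ i| ≤ 1` matters for the vertex capacities.
    have h1 := le_abs_self (G.vertexCap i - H.vertexCap i)
    have h2 := neg_le_abs (G.vertexCap i - H.vertexCap i)
    rcases hσ i with ⟨hi, -⟩ | ⟨hi, -⟩ | ⟨hi, -⟩ <;> rw [hi] <;> linarith
  have hsum : ∑ e ∈ G.edges, g e = ∑ e ∈ G.edges, |G.edgeCap e - H.edgeCap e| :=
    Finset.sum_congr rfl fun e he => if_pos he
  calc ∑ i, |G.residual i - H.residual i|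
      ≤ ∑ i, (|G.vertexCap i - H.vertexCap i| + σ i * CapacitatedGraph.level d i) :=
        Finset.sum_le_sum fun i _ => hvert i
    _ = ∑ i, |G.vertexCap i - H.vertexCap i| + ∑ i, σ i * CapacitatedGraph.level d i :=
        Finset.sum_add_distrib
    _ ≤ _ := by
        refine add_le_add_right ((CapacitatedGraph.sum_mul_level_le σ d g hd).trans ?_) _
        rw [← hsum]
        refine CapacitatedGraph.sum_sum_mk_le_two_mul_sum _ _ (fun e he => ?_)
          fun e he => if_neg he
        simp only [g, if_pos he]
        exact abs_nonneg _
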